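/- Let $(W,S)$ be a Coxeter system ($S$ and $W$ may be infinite), with length function $\ell$, and let $\bar S$ be the set of classes of elements of $S$ under conjugacy in $W$; write $\bar s$ for the class of $s\in S$. Let $\Gamma$ be a totally ordered abelian group (the order being compatible with the group law) and let $\varphi:\bar S\to\Gamma$ be any map; put $\varphi(s)=\varphi(\bar s)$. Let $\mathbb Z[\Gamma]=\bigoplus_{\gamma\in\Gamma}\mathbb Z e^{\gamma}$ be the group ring and let $\mathcal H(W,S,\varphi)$ be the Hecke algebra: the free $\mathbb Z[\Gamma]$-module with basis $(T_w^\varphi)_{w\in W}$ and with the $\mathbb Z[\Gamma]$-bilinear associative multiplication such that $T_wT_{w'}=T_{ww'}$ if $\ell(ww')=\ell(w)+\ell(w')$ and $(T_s-e^{\varphi(s)})(T_s+e^{-\varphi(s)})=0$ for $s\in S$. Let $h\mapsto\overline h$ be the antilinear involution of $\mathcal H(W,S,\varphi)$ with $\overline{e^\gamma}=e^{-\gamma}$ and $\overline{T_w}=T_{w^{-1}}^{-1}$. For $w\in W$, let $C_w^\varphi$ be the unique element of $\mathcal H(W,S,\varphi)$ such that $\overline{C_w^\varphi}=C_w^\varphi$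 and $C_w^\varphi-T_w^\varphi\in\bigoplus_{v\in W}\mathbb Z[\Gamma_{<0}]\,T_v^\varphi$, where $\mathbb Z[\Gamma_{<0}]=\bigoplus_{\gamma<0}\mathbb Z e^\gamma$; the family $(C_w^\varphi)_{w\in W}$ is a $\mathbb Z[\Gamma]$-basis of $\mathcal H(W,S,\varphi)$. For $x,y\in W$ write $x\leftarrow_L^\varphi y$ (respectively $x\leftarrow_R^\varphi y$, respectively $x\leftarrow_{LR}^\varphi y$) if there is $h\in\mathcal H(W,S,\varphi)$ such that the coefficient of $C_x^\varphi$ in $hC_y^\varphi$ (respectively in $C_y^\varphi h$, respectively in $hC_y^\varphi$ or in $C_y^\varphi h$), written in the basis $(C_w^\varphi)_{w\in W}$, is non-zero. For $?\in\{L,R,LR\}$, let $\leqslant_?^\varphi$ be the transitive closure of $\leftarrow_?^\varphi$ (a preorder), let $\sim_?^\varphi$ be the associated equivalence relation ($x\sim_?^\varphi y$ if and only if $x\leqslant_?^\varphi y$ and $y\leqslant_?^\varphi x$), and let $\mathrm{Cell}_?^\varphi(w)=\{x\in W : x\sim_?^\varphi w\}$. Proposition. Let $\Gamma'$ be a totally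 ordered abelian group, let $\rho:\Gamma\to\Gamma'$ be a strictly increasing morphism of groups and let $?\in\{L,R,LR\}$. Let $\rho_*:\mathcal H(W,S,\varphi)\to\mathcal H(W,S,\rho\circ\varphi)$ be the map, semilinear with respect to the ring morphism $\mathbb Z[\Gamma]\to\mathbb Z[\Gamma']$, $e^\gamma\mapsto e^{\rho(\gamma)}$, that sends $T_w^\varphi$ to $T_w^{\rho\circ\varphi}$ for all $w\in W$. Then: (a) $\rho_*$ is injective. (b) For all $w\in W$, $\rho_*(C_w^\varphi)=C_w^{\rho\circ\varphi}$. (c) The relations $\leqslant_?^\varphi$ and $\leqslant_?^{\rho\circ\varphi}$ coincide, and the relations $\sim_?^\varphi$ and $\sim_?^{\rho\circ\varphi}$ coincide. (d) For all $w\in W$, $\mathrm{Cell}_?^\varphi(w)=\mathrm{Cell}_?^{\rho\circ\varphi}(w)$. -/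

import Mathlib

noncomputable section

namespace HeckeKL

section Combinatorics

theorem endMul_apply {X : Type*} (f g : Function.End X) (x : X) : (f * g) x = f (g x) := rfl

theorem endOne_apply {X : Type*} (x : X) : (1 : Function.End X) x = x := rfl

variable {B W : Type*} [Group W] {M : CoxeterMatrix B} (cs : CoxeterSystem M W)

open Classical in
/-- The action of a simple reflection on `W × ℤ/2ℤ`, used only to prove `length_exchange`. -/
def twist (i : B) : Function.End (W × ZMod 2) := fun p =>
  (cs.simple i * p.1 * cs.simple i, p.2 + if p.1 = cs.simple i then 1 else 0)

open Classical in
theorem twist_pow (i j : B) (m : ℕ) (r : W) (ε : ZMod 2) :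
    ((twist cs i * twist cs j) ^ m) (r, ε) =
      ((cs.simple i * cs.simple j) ^ m * r * ((cs.simple i * cs.simple j) ^ m)⁻¹,
        ε + ∑ k ∈ Finset.range (2 * m),
          if r = ((cs.simple i * cs.simple j) ^ k)⁻¹ * cs.simple j then 1 else 0) := by
  induction m with
  | zero => simp [endOne_apply]
  | succ m ih =>
    rw [pow_succ', endMul_apply, ih]
    set c := cs.simple i * cs.simple j with hc
    have hcinv : c⁻¹ = cs.simple j * cs.simple i := by simp [hc]
    have hji : cs.simple j * c ^ m = (c ^ m)⁻¹ * cs.simple j := by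
      have h1 : cs.simple j * c * (cs.simple j)⁻¹ = c⁻¹ := by
        rw [hcinv, hc]; simp [mul_assoc]
      have h2 : cs.simple j * c ^ m * (cs.simple j)⁻¹ = (c ^ m)⁻¹ := by
        rw [← conj_pow, h1, inv_pow]
      rw [← h2]; simp
    have h2m : c ^ (2 * m) = c ^ m * c ^ m := by rw [two_mul, pow_add]
    simp only [endMul_apply, twist]
    rw [show 2 * (m + 1) = 2 * m + 1 + 1 by ring, Finset.sum_range_succ, Finset.sum_range_succ]
    have e1 : (c ^ m * r * (c ^ m)⁻¹ = cs.simple j) ↔ r = (c ^ (2 * m))⁻¹ * cs.simple j := by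
      have h3 : (c ^ (2 * m))⁻¹ * cs.simple j = (c ^ m)⁻¹ * cs.simple j * c ^ m := by
        rw [h2m, mul_inv_rev]
        simp only [mul_assoc]
        rw [hji]
      rw [h3]
      constructor
      · intro h; rw [← h]; group
      · rintro rfl; group
    have e2 : (cs.simple j * (c ^ m * r * (c ^ m)⁻¹) * cs.simple j = cs.simple i) ↔
        r = (c ^ (2 * m + 1))⁻¹ * cs.simple j := by
      have h4 : c ^ (2 * m + 1) = c ^ m * c * c ^ m := by
        rw [← pow_succ, ← pow_add]; congr 1; ring
      have h3 : (c ^ (2 * m + 1))⁻¹ * cs.simple j =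
          (c ^ m)⁻¹ * (cs.simple j * cs.simple i * cs.simple j) * c ^ m := by
        rw [h4, mul_inv_rev, mul_inv_rev, hcinv]
        simp only [mul_assoc]
        rw [hji]
      rw [h3]
      constructor
      · intro h
        rw [← h]
        simp [mul_assoc]
      · rintro rfl
        simp [mul_assoc]
    simp only [e1, e2, Prod.mk.injEq]
    constructor
    · rw [pow_succ', mul_inv_rev, hcinv, hc]
      simp only [mul_assoc]
    · ring

theorem twist_liftable : M.IsLiftable (twist cs) := by
  classical
  intro i j
  funext p
  obtain ⟨r, ε⟩ := p
  rw [twist_pow, two_mul, Finset.sum_range_add]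
  have hp : (cs.simple i * cs.simple j) ^ M i j = 1 := cs.simple_mul_simple_pow i j
  simp only [pow_add, hp, one_mul, inv_one, mul_one]
  rw [CharTwo.add_self_eq_zero]
  simp [endOne_apply]

/-- The extension of `twist` to `W`. -/
def twistHom : W →* Function.End (W × ZMod 2) := cs.lift ⟨twist cs, twist_liftable cs⟩

theorem twistHom_simple (i : B) : twistHom cs (cs.simple i) = twist cs i :=
  cs.lift_apply_simple (twist_liftable cs) i

open Classical in
theorem twistHom_wordProd (ω : List B) (r : W) (ε : ZMod 2) :
    twistHom cs (cs.wordProd ω) (r, ε) =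
      (cs.wordProd ω * r * (cs.wordProd ω)⁻¹, ε + ((cs.rightInvSeq ω).count r : ZMod 2)) := by
  induction ω with
  | nil => simp [endOne_apply]
  | cons i ω ih =>
    rw [cs.wordProd_cons, map_mul, endMul_apply, ih, twistHom_simple]
    have e : (cs.wordProd ω * r * (cs.wordProd ω)⁻¹ = cs.simple i) ↔
        (cs.wordProd ω)⁻¹ * cs.simple i * cs.wordProd ω = r := by
      constructor
      · intro h; rw [← h]; group
      · rintro rfl; group
    simp only [twist, CoxeterSystem.rightInvSeq, List.count_cons, e, beq_iff_eq, Prod.mk.injEq]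
    constructor
    · simp [mul_assoc]
    · push_cast
      ring

/-- The parity of the number of occurrences of `r` in the inversion sequence of a word for `w`. -/
def invParity (w r : W) : ZMod 2 := (twistHom cs w (r, 0)).2

theorem twistHom_apply (w r : W) (ε : ZMod 2) :
    twistHom cs w (r, ε) = (w * r * w⁻¹, ε + invParity cs w r) := by
  obtain ⟨ω, rfl⟩ := cs.wordProd_surjective w
  simp [invParity, twistHom_wordProd]

theorem invParity_mul (w v r : W) :
    invParity cs (w * v) r = invParity cs v r + invParity cs w (v * r * v⁻¹) := by
  have := twistHom_apply cs (w * v) r 0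
  rw [map_mul, endMul_apply, twistHom_apply, twistHom_apply] at this
  simpa using (congrArg Prod.snd this).symm

open Classical in
theorem invParity_simple (i : B) (r : W) :
    invParity cs (cs.simple i) r = if r = cs.simple i then 1 else 0 := by
  simp [invParity, twistHom_simple, twist]

theorem isRightInversion_of_invParity {w r : W} (h : invParity cs w r ≠ 0) :
    cs.IsRightInversion w r := by
  classical
  obtain ⟨ω, hω, rfl⟩ := cs.exists_isReduced w
  apply cs.isRightInversion_of_mem_rightInvSeq hω
  by_contra hr
  apply h
  simp [invParity, twistHom_wordProd, List.count_eq_zero_of_not_mem hr]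

theorem isRightDescent_iff_invParity (w : W) (i : B) :
    cs.length (w * cs.simple i) < cs.length w ↔ invParity cs w (cs.simple i) ≠ 0 := by
  constructor
  · intro h h0
    have h1 : invParity cs (w * cs.simple i) (cs.simple i) ≠ 0 := by
      rw [invParity_mul, invParity_simple]
      simp [h0]
    have h2 := (isRightInversion_of_invParity cs h1).2
    rw [mul_assoc, cs.simple_mul_simple_self, mul_one] at h2
    omega
  · intro h
    exact (isRightInversion_of_invParity cs h).2

/-- If `s w ≠ w t`, then `t` is a right descent of `s w` if and only if it is one of `w`. -/
theorem length_exchange (w : W) (i j : B) (h : cs.simple i * w ≠ w * cs.simple j) :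
    cs.length (cs.simple i * w * cs.simple j) < cs.length (cs.simple i * w) ↔
      cs.length (w * cs.simple j) < cs.length w := by
  rw [isRightDescent_iff_invParity, isRightDescent_iff_invParity, invParity_mul, invParity_simple,
    if_neg, add_zero]
  intro h'
  apply h
  rw [← h']
  group

/-- If `s w ≠ w t`, then `s` is a left descent of `w t` if and only if it is one of `w`. -/
theorem length_exchange' (w : W) (i j : B) (h : cs.simple i * w ≠ w * cs.simple j) :
    cs.length (cs.simple i * w * cs.simple j) < cs.length (w * cs.simple j) ↔
      cs.length (cs.simple i * w) < cs.length w := by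
  have h' : cs.simple j * w⁻¹ ≠ w⁻¹ * cs.simple i := by
    intro e
    apply h
    have := congrArg (fun x => x⁻¹) e
    simpa using this.symm
  have := length_exchange cs w⁻¹ j i h'
  rw [← cs.length_inv (cs.simple j * w⁻¹ * cs.simple i), ← cs.length_inv (cs.simple j * w⁻¹),
    ← cs.length_inv (w⁻¹ * cs.simple i), cs.length_inv w] at this
  simpa [mul_assoc] using this

end Combinatorics

section Algebra

variable {B W : Type*} [Group W] {M : CoxeterMatrix B}

/-- Simple reflections are identified when they are conjugate in `W`. -/
def conjSetoid (cs : CoxeterSystem M W) : Setoid B where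
  r i j := IsConj (cs.simple i) (cs.simple j)
  iseqv := ⟨fun _ => IsConj.refl _, fun h => h.symm, fun h h' => h.trans h'⟩

/-- The set of classes of simple reflections under conjugacy in `W`. -/
abbrev SimpleClass (cs : CoxeterSystem M W) : Type _ := Quotient (conjSetoid cs)

/-- The conjugacy class of the simple reflection of index `i`. -/
def simpleClass (cs : CoxeterSystem M W) (i : B) : SimpleClass cs :=
  Quotient.mk (conjSetoid cs) i

/-- The group ring `ℤ[Γ]`. -/
abbrev GroupRing (Γ : Type*) [AddCommGroup Γ] : Type _ := AddMonoidAlgebra ℤ Γ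

/-- The element `e ^ γ` of the group ring `ℤ[Γ]`. -/
def expo {Γ : Type*} [AddCommGroup Γ] (γ : Γ) : GroupRing Γ := AddMonoidAlgebra.single γ 1

theorem expo_mul_expo {Γ : Type*} [AddCommGroup Γ] (γ δ : Γ) :
    expo γ * expo δ = expo (γ + δ) := by
  simp [expo, AddMonoidAlgebra.single_mul_single]

theorem expo_zero {Γ : Type*} [AddCommGroup Γ] : expo (0 : Γ) = 1 := rfl

/-- The ring morphism `ℤ[Γ] → ℤ[Γ']` induced by a morphism of groups: `e ^ γ ↦ e ^ (ρ γ)`. -/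
abbrev groupRingMap {Γ Γ' : Type*} [AddCommGroup Γ] [AddCommGroup Γ'] (ρ : Γ →+ Γ') :
    GroupRing Γ →+* GroupRing Γ' := AddMonoidAlgebra.mapDomainRingHom ℤ ρ

theorem groupRingMap_expo {Γ Γ' : Type*} [AddCommGroup Γ] [AddCommGroup Γ'] (ρ : Γ →+ Γ') (γ : Γ) :
    groupRingMap ρ (expo γ) = expo (ρ γ) := AddMonoidAlgebra.mapDomain_single

/-- The involution `e ^ γ ↦ e ^ (-γ)` of the group ring `ℤ[Γ]`. -/
abbrev barCoeff (Γ : Type*) [AddCommGroup Γ] : GroupRing Γ →+* GroupRing Γ :=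
  groupRingMap (negAddMonoidHom : Γ →+ Γ)

/-- The underlying free `ℤ[Γ]`-module of the Hecke algebra with parameter `φ`. -/
def Hecke (cs : CoxeterSystem M W) {Γ : Type*} [AddCommGroup Γ] (_φ : SimpleClass cs → Γ) :
    Type _ := W →₀ GroupRing Γ

variable {cs : CoxeterSystem M W} {Γ : Type*} [AddCommGroup Γ] {φ : SimpleClass cs → Γ}

instance : AddCommGroup (Hecke cs φ) := inferInstanceAs (AddCommGroup (W →₀ GroupRing Γ))

instance : Module (GroupRing Γ) (Hecke cs φ) :=
  inferInstanceAs (Module (GroupRing Γ) (W →₀ GroupRing Γ))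

variable (φ) in
/-- The standard basis `(T_w)` of the Hecke algebra. -/
def T : Module.Basis W (GroupRing Γ) (Hecke cs φ) :=
  Module.Basis.ofRepr (LinearEquiv.refl (GroupRing Γ) (W →₀ GroupRing Γ))

theorem hecke_induction {p : Hecke cs φ → Prop} (h : Hecke cs φ) (zero : p 0)
    (add : ∀ x y, p x → p y → p (x + y)) (smul : ∀ (a : GroupRing Γ) (w : W), p (a • T φ w)) : p h := by
  rw [← (T φ).linearCombination_repr h, Finsupp.linearCombination_apply, Finsupp.sum]
  exact Finset.sum_induction _ p add zero fun w _ => smul _ _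

variable (φ) in
/-- The difference `e ^ φ(s) - e ^ (-φ(s))`. -/
def xi (i : B) : GroupRing Γ := expo (φ (simpleClass cs i)) - expo (-φ (simpleClass cs i))

open Classical in
variable (φ) in
/-- Left multiplication by `T_s`. -/
def leftOp (i : B) : Module.End (GroupRing Γ) (Hecke cs φ) :=
  (T φ).constr (GroupRing Γ) fun w =>
    if cs.length w < cs.length (cs.simple i * w) then T φ (cs.simple i * w)
    else T φ (cs.simple i * w) + xi φ i • T φ w

open Classical in
variable (φ) in
/-- Right multiplication by `T_s`. -/
def rightOp (i : B) : Module.End (GroupRing Γ) (Hecke cs φ) :=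
  (T φ).constr (GroupRing Γ) fun w =>
    if cs.length w < cs.length (w * cs.simple i) then T φ (w * cs.simple i)
    else T φ (w * cs.simple i) + xi φ i • T φ w

open Classical in
theorem leftOp_T (i : B) (w : W) : leftOp φ i (T φ w) = T φ (cs.simple i * w) +
    (if cs.length (cs.simple i * w) < cs.length w then xi φ i else 0) • T φ w := by
  rw [leftOp, Module.Basis.constr_basis]
  have := cs.length_simple_mul_ne w i
  split_ifs <;> first | omega | simp

open Classical in
theorem rightOp_T (i : B) (w : W) : rightOp φ i (T φ w) = T φ (w * cs.simple i) +
    (if cs.length (w * cs.simple i) < cs.length w then xi φ i else 0) • T φ w := by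
  rw [rightOp, Module.Basis.constr_basis]
  have := cs.length_mul_simple_ne w i
  split_ifs <;> first | omega | simp

theorem leftOp_rightOp (i j : B) (h : Hecke cs φ) :
    leftOp φ i (rightOp φ j h) = rightOp φ j (leftOp φ i h) := by
  classical
  suffices leftOp φ i ∘ₗ rightOp φ j = rightOp φ j ∘ₗ leftOp φ i from LinearMap.congr_fun this h
  refine (T φ).ext fun w => ?_
  simp only [LinearMap.comp_apply, leftOp_T, rightOp_T, map_add, map_smul, smul_add, ← mul_assoc]
  by_cases hw : cs.simple i * w = w * cs.simple j
  · have hxi : xi φ i = xi φ j := by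
      have : simpleClass cs i = simpleClass cs j := by
        refine Quotient.sound (s := conjSetoid cs) ?_
        refine (isConj_iff.2 ⟨w⁻¹, ?_⟩ : IsConj (cs.simple i) (cs.simple j))
        rw [mul_assoc, inv_inv, hw]
        simp
      rw [xi, xi, this]
    have e1 : w * cs.simple j * cs.simple j = w := by simp
    rw [hw, e1, hxi]
  · have h1 := length_exchange cs w i j hw
    have h2 := length_exchange' cs w i j hw
    simp only [h1, h2, smul_smul]
    split_ifs <;> simp only [zero_smul, mul_comm (xi φ i), zero_mul, mul_zero] <;> abel

theorem hecke_ext {f g : Module.End (GroupRing Γ) (Hecke cs φ)}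
    (hf : ∀ i h, f (rightOp φ i h) = rightOp φ i (f h))
    (hg : ∀ i h, g (rightOp φ i h) = rightOp φ i (g h))
    (h1 : f (T φ 1) = g (T φ 1)) : f = g := by
  refine (T φ).ext fun w => ?_
  induction hn : cs.length w generalizing w with
  | zero => rw [cs.length_eq_zero_iff.1 hn, h1]
  | succ n ih =>
    obtain ⟨i, hi⟩ := cs.exists_rightDescent_of_ne_one (w := w) (by
      rintro rfl
      simp at hn)
    have hlen := cs.isRightDescent_iff.1 hi
    have hT : T φ w = rightOp φ i (T φ (w * cs.simple i)) := by
      rw [rightOp_T, if_neg]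
      · simp
      · simp only [cs.simple_mul_simple_cancel_right]
        omega
    rw [hT, hf, hg, ih _ (by omega)]

variable (cs) in
/-- A chosen reduced word of `w`. -/
def redWord (w : W) : List B := (cs.exists_isReduced w).choose

theorem redWord_isReduced (w : W) : cs.IsReduced (redWord cs w) :=
  (cs.exists_isReduced w).choose_spec.1

theorem wordProd_redWord (w : W) : cs.wordProd (redWord cs w) = w :=
  (cs.exists_isReduced w).choose_spec.2.symm

variable (φ) in
/-- Left multiplication by `T_s ⋯ T_t` for a word `s, …, t`. -/
def wordOp (ω : List B) : Module.End (GroupRing Γ) (Hecke cs φ) := (ω.map (leftOp φ)).prod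

theorem wordOp_rightOp (ω : List B) (i : B) (h : Hecke cs φ) :
    wordOp φ ω (rightOp φ i h) = rightOp φ i (wordOp φ ω h) := by
  induction ω with
  | nil => simp [wordOp]
  | cons j ω ih =>
    simp only [wordOp, List.map_cons, List.prod_cons, Module.End.mul_apply] at ih ⊢
    rw [ih, leftOp_rightOp]

theorem wordOp_T_one {ω : List B} (hω : cs.IsReduced ω) :
    wordOp φ ω (T φ 1) = T φ (cs.wordProd ω) := by
  induction ω with
  | nil => simp [wordOp]
  | cons j ω ih =>
    have hω' : cs.IsReduced ω := by simpa using hω.drop 1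
    have ih' := ih hω'
    simp only [wordOp, List.map_cons, List.prod_cons, Module.End.mul_apply] at ih' ⊢
    have e1 := hω.eq
    have e2 := hω'.eq
    rw [ih', leftOp_T, if_neg, zero_smul, add_zero, cs.wordProd_cons]
    rw [← cs.wordProd_cons, e1, e2]
    simp

variable (φ) in
/-- The multiplication of the Hecke algebra, as a map to the endomorphisms: `T_w` acts as the
product of the operators `T_s` along a reduced word of `w`. -/
def mulMap : Hecke cs φ →ₗ[GroupRing Γ] Module.End (GroupRing Γ) (Hecke cs φ) :=
  (T φ).constr (GroupRing Γ) fun w => wordOp φ (redWord cs w)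

theorem mulMap_T (w : W) : mulMap φ (T φ w) = wordOp φ (redWord cs w) :=
  Module.Basis.constr_basis _ _ _ _

theorem mulMap_rightOp (h k : Hecke cs φ) (i : B) :
    mulMap φ h (rightOp φ i k) = rightOp φ i (mulMap φ h k) := by
  induction h using hecke_induction with
  | zero => simp
  | add x y hx hy => simp [hx, hy]
  | smul a w => simp [mulMap_T, wordOp_rightOp]

theorem mulMap_T_one (h : Hecke cs φ) : mulMap φ h (T φ 1) = h := by
  induction h using hecke_induction with
  | zero => simp
  | add x y hx hy => simp [hx, hy]
  | smul a w =>
    simp [mulMap_T, wordOp_T_one (redWord_isReduced w), wordProd_redWord]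

theorem mulMap_eq {f : Module.End (GroupRing Γ) (Hecke cs φ)}
    (hf : ∀ i h, f (rightOp φ i h) = rightOp φ i (f h)) : mulMap φ (f (T φ 1)) = f :=
  hecke_ext (fun i h => mulMap_rightOp _ h i) hf (mulMap_T_one _)

theorem mulMap_mulMap (h k : Hecke cs φ) :
    mulMap φ (mulMap φ h k) = mulMap φ h * mulMap φ k := by
  have := mulMap_eq (φ := φ) (f := mulMap φ h * mulMap φ k) (fun i x => by
    simp only [Module.End.mul_apply, mulMap_rightOp])
  rwa [Module.End.mul_apply, mulMap_T_one] at this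

/-- The Hecke algebra is an associative ring with unit `T_1`. -/
instance : Ring (Hecke cs φ) :=
  { (inferInstance : AddCommGroup (Hecke cs φ)) with
    mul := fun h k => mulMap φ h k
    one := T φ 1
    left_distrib := fun h k l => map_add (mulMap φ h) k l
    right_distrib := fun h k l => by
      change mulMap φ (h + k) l = mulMap φ h l + mulMap φ k l
      rw [map_add, LinearMap.add_apply]
    zero_mul := fun h => by
      change mulMap φ 0 h = 0
      rw [map_zero, LinearMap.zero_apply]
    mul_zero := fun h => map_zero (mulMap φ h)
    mul_assoc := fun h k l => by
      change mulMap φ (mulMap φ h k) l = mulMap φ h (mulMap φ k l)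
      rw [mulMap_mulMap, Module.End.mul_apply]
    one_mul := fun h => by
      change mulMap φ (T φ 1) h = h
      rw [show T φ 1 = (1 : Module.End (GroupRing Γ) (Hecke cs φ)) (T φ 1) from rfl,
        mulMap_eq (fun _ _ => rfl), Module.End.one_apply]
    mul_one := fun h => mulMap_T_one h }

theorem mul_def (h k : Hecke cs φ) : h * k = mulMap φ h k := rfl

theorem T_one : T φ 1 = (1 : Hecke cs φ) := rfl

/-- The Hecke algebra is an algebra over `ℤ[Γ]`. -/
instance : Algebra (GroupRing Γ) (Hecke cs φ) :=
  Algebra.ofModule (fun a h k => by simp [mul_def]) (fun a h k => by simp [mul_def])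

theorem T_simple_mul (i : B) (h : Hecke cs φ) : T φ (cs.simple i) * h = leftOp φ i h := by
  have h1 : leftOp φ i (T φ 1) = T φ (cs.simple i) := by simp [leftOp_T]
  rw [mul_def, ← h1, mulMap_eq fun j k => leftOp_rightOp i j k]

/-- `T_w T_v = T_{wv}` if the lengths add up. -/
theorem T_mul_T {w v : W} (h : cs.length (w * v) = cs.length w + cs.length v) :
    T φ w * T φ v = T φ (w * v) := by
  induction hn : cs.length w generalizing w with
  | zero =>
    rw [cs.length_eq_zero_iff.1 hn, T_one, one_mul, one_mul]
  | succ n ih =>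
    obtain ⟨i, hi⟩ := cs.exists_leftDescent_of_ne_one (w := w) (by
      rintro rfl
      simp at hn)
    have hlen := cs.isLeftDescent_iff.1 hi
    have h3 := cs.length_mul_le (cs.simple i * w) v
    have h4 := cs.length_simple_mul (w * v) i
    rw [mul_assoc] at h3
    have ih' := ih (w := cs.simple i * w) (by rw [mul_assoc]; omega) (by omega)
    have hT : ∀ u : W, cs.length (cs.simple i * u) + 1 = cs.length u →
        T φ u = T φ (cs.simple i) * T φ (cs.simple i * u) := by
      intro u hu
      rw [T_simple_mul, leftOp_T, if_neg]
      · simp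
      · simp only [cs.simple_mul_simple_cancel_left]
        omega
    rw [hT w hlen, mul_assoc, ih', mul_assoc, ← hT (w * v) (by omega)]

/-- The quadratic relation. -/
theorem T_quadratic (i : B) :
    (T φ (cs.simple i) - algebraMap _ _ (expo (φ (simpleClass cs i)))) *
      (T φ (cs.simple i) + algebraMap _ _ (expo (-φ (simpleClass cs i)))) = 0 := by
  have h1 : T φ (cs.simple i) * T φ (cs.simple i) = 1 + xi φ i • T φ (cs.simple i) := by
    rw [T_simple_mul, leftOp_T]
    simp [T_one]
  have h2 : expo (φ (simpleClass cs i)) * expo (-φ (simpleClass cs i)) = 1 := by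
    rw [expo_mul_expo, add_neg_cancel, expo_zero]
  rw [sub_mul, mul_add, mul_add, h1, ← map_mul, h2, map_one, ← Algebra.commutes, ← Algebra.smul_def,
    ← Algebra.smul_def, xi, sub_smul]
  abel

end Algebra

section Semilinear

variable {B W : Type*} [Group W] {M : CoxeterMatrix B} {cs : CoxeterSystem M W}
variable {Γ Γ' : Type*} [AddCommGroup Γ] [AddCommGroup Γ']
variable {φ : SimpleClass cs → Γ} {φ' : SimpleClass cs → Γ'}

variable (φ) in
/-- The semilinear map sending `T_w` to `v w`. -/
def semiConstr (σ : GroupRing Γ →+* GroupRing Γ') (v : W → Hecke cs φ') :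
    Hecke cs φ →ₛₗ[σ] Hecke cs φ' where
  toFun h := ((T φ).repr h).sum fun w a => σ a • v w
  map_add' h k := by
    rw [map_add, Finsupp.sum_add_index']
    · simp
    · intro w a b; rw [map_add, add_smul]
  map_smul' a h := by
    rw [map_smul, Finsupp.sum_smul_index, Finsupp.smul_sum]
    · simp [mul_smul]
    · simp

theorem semiConstr_T (σ : GroupRing Γ →+* GroupRing Γ') (v : W → Hecke cs φ') (w : W) :
    semiConstr φ σ v (T φ w) = v w := by
  change ((T φ).repr (T φ w)).sum (fun w a => σ a • v w) = v w
  rw [Module.Basis.repr_self, Finsupp.sum_single_index] <;> simp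

variable (φ) in
/-- The bar involution: the antilinear map sending `T_w` to the inverse of `T_{w⁻¹}`. The elements
`T_w` are invertible, see `isUnit_T`. -/
def bar : Hecke cs φ →ₛₗ[barCoeff Γ] Hecke cs φ :=
  semiConstr φ (barCoeff Γ) fun w => Ring.inverse (T φ w⁻¹)

variable (φ) in
/-- The map `ρ_*` induced by a morphism `ρ : Γ → Γ'`: the semilinear map sending `T_w` to
`T_w`. -/
def pushforward (ρ : Γ →+ Γ') : Hecke cs φ →ₛₗ[groupRingMap ρ] Hecke cs (ρ ∘ φ) :=
  semiConstr φ (groupRingMap ρ) fun w => T (ρ ∘ φ) w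

end Semilinear

section Bar

variable {B W : Type*} [Group W] {M : CoxeterMatrix B} {cs : CoxeterSystem M W}
variable {Γ : Type*} [AddCommGroup Γ] {φ : SimpleClass cs → Γ}

theorem T_simple_sq (i : B) :
    T φ (cs.simple i) * T φ (cs.simple i) = 1 + xi φ i • T φ (cs.simple i) := by
  rw [T_simple_mul, leftOp_T]
  simp [T_one]

variable (φ) in
/-- `T_s` as a unit of the Hecke algebra. -/
def unitT (i : B) : (Hecke cs φ)ˣ where
  val := T φ (cs.simple i)
  inv := T φ (cs.simple i) - xi φ i • 1
  val_inv := by rw [mul_sub, T_simple_sq]; simp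
  inv_val := by rw [sub_mul, T_simple_sq]; simp

theorem isUnit_T (w : W) : IsUnit (T φ w) := by
  induction hn : cs.length w generalizing w with
  | zero => rw [cs.length_eq_zero_iff.1 hn, T_one]; exact isUnit_one
  | succ n ih =>
    obtain ⟨i, hi⟩ := cs.exists_leftDescent_of_ne_one (w := w) (by
      rintro rfl
      simp at hn)
    have hlen := cs.isLeftDescent_iff.1 hi
    have := T_mul_T (φ := φ) (w := cs.simple i) (v := cs.simple i * w) (by
      rw [cs.simple_mul_simple_cancel_left, cs.length_simple]; omega)
    rw [cs.simple_mul_simple_cancel_left] at this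
    rw [← this]
    exact (unitT φ i).isUnit.mul (ih _ (by omega))

theorem bar_T (w : W) : bar φ (T φ w) = Ring.inverse (T φ w⁻¹) := semiConstr_T _ _ _

theorem bar_T_one : bar φ (T φ 1) = T φ 1 := by
  rw [bar_T, inv_one, T_one, Ring.inverse_one]

theorem bar_T_simple (i : B) : bar φ (T φ (cs.simple i)) = T φ (cs.simple i) - xi φ i • 1 := by
  rw [bar_T, cs.inv_simple]
  exact Ring.inverse_unit (unitT φ i)

theorem bar_xi (i : B) : barCoeff Γ (xi φ i) = -xi φ i := by
  rw [xi, map_sub, groupRingMap_expo, groupRingMap_expo]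
  simp

theorem bar_T_mul_of_lt {i : B} {w : W} (h : cs.length w < cs.length (cs.simple i * w)) :
    bar φ (T φ (cs.simple i * w)) = bar φ (T φ (cs.simple i)) * bar φ (T φ w) := by
  rw [bar_T, bar_T, bar_T, mul_inv_rev]
  have h1 := cs.length_simple_mul w i
  have h2 : T φ w⁻¹ * T φ (cs.simple i)⁻¹ = T φ (w⁻¹ * (cs.simple i)⁻¹) := T_mul_T (by
    rw [← mul_inv_rev, cs.length_inv, cs.length_inv, cs.length_inv, cs.length_simple]
    omega)
  rw [← h2]
  obtain ⟨u, hu⟩ := isUnit_T (φ := φ) w⁻¹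
  obtain ⟨v, hv⟩ := isUnit_T (φ := φ) (cs.simple i)⁻¹
  rw [← hu, ← hv, ← Units.val_mul, Ring.inverse_unit, Ring.inverse_unit, Ring.inverse_unit,
    mul_inv_rev, Units.val_mul]

theorem bar_T_simple_mul (i : B) (h : Hecke cs φ) :
    bar φ (T φ (cs.simple i) * h) = bar φ (T φ (cs.simple i)) * bar φ h := by
  induction h using hecke_induction with
  | zero => simp
  | add x y hx hy => rw [mul_add, map_add, hx, hy, map_add, mul_add]
  | smul a w =>
    rw [mul_smul_comm, map_smulₛₗ, map_smulₛₗ, mul_smul_comm]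
    congr 1
    rw [T_simple_mul, leftOp_T]
    split_ifs with hw
    · have h1 := bar_T_mul_of_lt (φ := φ) (i := i) (w := cs.simple i * w) (by simpa using hw)
      rw [cs.simple_mul_simple_cancel_left] at h1
      rw [map_add, map_smulₛₗ, bar_xi, h1]
      have h2 : T φ (cs.simple i) = bar φ (T φ (cs.simple i)) + xi φ i • 1 := by
        rw [bar_T_simple]; abel
      have h3 : T φ (cs.simple i) * (bar φ (T φ (cs.simple i)) * bar φ (T φ (cs.simple i * w))) =
          bar φ (T φ (cs.simple i * w)) := by
        rw [bar_T_simple]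
        exact (unitT φ i).mul_inv_cancel_left _
      rw [← sub_eq_zero]
      nth_rewrite 1 [← h3]
      nth_rewrite 1 [h2]
      rw [add_mul, smul_mul_assoc, one_mul, neg_smul]
      abel
    · rw [zero_smul, add_zero]
      apply bar_T_mul_of_lt
      have := cs.length_simple_mul_ne w i
      omega

theorem barCoeff_barCoeff (a : GroupRing Γ) : barCoeff Γ (barCoeff Γ a) = a := by
  rw [← RingHom.comp_apply, barCoeff, groupRingMap, ← AddMonoidAlgebra.mapDomainRingHom_comp]
  have : (negAddMonoidHom : Γ →+ Γ).comp negAddMonoidHom = AddMonoidHom.id Γ := by ext; simp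
  rw [this]
  simp

theorem bar_bar (h : Hecke cs φ) : bar φ (bar φ h) = h := by
  induction h using hecke_induction with
  | zero => simp
  | add x y hx hy => rw [map_add, map_add, hx, hy]
  | smul a w =>
    rw [map_smulₛₗ, map_smulₛₗ, barCoeff_barCoeff]
    congr 1
    induction hn : cs.length w generalizing w with
    | zero => rw [cs.length_eq_zero_iff.1 hn, bar_T_one, bar_T_one]
    | succ n ih =>
      obtain ⟨i, hi⟩ := cs.exists_leftDescent_of_ne_one (w := w) (by
        rintro rfl
        simp at hn)
      have hlen := cs.isLeftDescent_iff.1 hi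
      have h1 : T φ (cs.simple i) * T φ (cs.simple i * w) = T φ w := by
        rw [T_mul_T, cs.simple_mul_simple_cancel_left]
        rw [cs.simple_mul_simple_cancel_left, cs.length_simple]; omega
      rw [← h1, bar_T_simple_mul, bar_T_simple, sub_mul, map_sub, bar_T_simple_mul,
        smul_mul_assoc, one_mul, map_smulₛₗ, bar_xi, ih _ (by omega), bar_T_simple, sub_mul,
        smul_mul_assoc, one_mul]
      simp

/-- The elements supported on elements of `W` of length smaller than `n`. -/
def lower (cs : CoxeterSystem M W) (φ : SimpleClass cs → Γ) (n : ℕ) :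
    Submodule (GroupRing Γ) (Hecke cs φ) where
  carrier := {h | ∀ w, n ≤ cs.length w → (T φ).repr h w = 0}
  zero_mem' := by simp
  add_mem' {x y} hx hy w hw := by simp [hx w hw, hy w hw]
  smul_mem' a x hx w hw := by simp [hx w hw]

theorem mem_lower {n : ℕ} {h : Hecke cs φ} :
    h ∈ lower cs φ n ↔ ∀ w, n ≤ cs.length w → (T φ).repr h w = 0 := Iff.rfl

theorem lower_mono {m n : ℕ} (h : m ≤ n) : lower cs φ m ≤ lower cs φ n :=
  fun _ hx w hw => hx w (h.trans hw)

theorem T_mem_lower {n : ℕ} {w : W} (h : cs.length w < n) : T φ w ∈ lower cs φ n := by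
  intro v hv
  rw [Module.Basis.repr_self, Finsupp.single_eq_of_ne]
  rintro rfl
  omega

theorem exists_mem_lower (h : Hecke cs φ) : ∃ n, h ∈ lower cs φ n := by
  refine ⟨(((T φ).repr h).support.sup cs.length) + 1, fun w hw => ?_⟩
  by_contra h0
  have := Finset.le_sup (f := cs.length) (Finsupp.mem_support_iff.2 h0)
  omega

@[elab_as_elim]
theorem lower_induction {n : ℕ} {p : Hecke cs φ → Prop} {h : Hecke cs φ} (hh : h ∈ lower cs φ n)
    (zero : p 0) (add : ∀ x y, p x → p y → p (x + y))
    (smul : ∀ (a : GroupRing Γ) (w : W), cs.length w < n → p (a • T φ w)) : p h := by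
  rw [← (T φ).linearCombination_repr h, Finsupp.linearCombination_apply, Finsupp.sum]
  refine Finset.sum_induction _ p add zero fun w hw => smul _ _ ?_
  by_contra hn
  exact Finsupp.mem_support_iff.1 hw (hh w (not_lt.1 hn))

theorem leftOp_mem_lower {n : ℕ} {h : Hecke cs φ} (hh : h ∈ lower cs φ n) (i : B) :
    leftOp φ i h ∈ lower cs φ (n + 1) := by
  refine lower_induction hh ?_ (fun x y hx hy => ?_) (fun a w hw => ?_)
  · simp
  · rw [map_add]; exact add_mem hx hy
  · rw [map_smul, leftOp_T]
    have := cs.length_simple_mul w i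
    exact Submodule.smul_mem _ _ (add_mem (T_mem_lower (by omega))
      (Submodule.smul_mem _ _ (T_mem_lower (by omega))))

theorem bar_T_sub_mem (w : W) : bar φ (T φ w) - T φ w ∈ lower cs φ (cs.length w) := by
  induction hn : cs.length w generalizing w with
  | zero => rw [cs.length_eq_zero_iff.1 hn, bar_T_one, sub_self]; exact zero_mem _
  | succ n ih =>
    obtain ⟨i, hi⟩ := cs.exists_leftDescent_of_ne_one (w := w) (by
      rintro rfl
      simp at hn)
    have hlen := cs.isLeftDescent_iff.1 hi
    have h1 : T φ (cs.simple i) * T φ (cs.simple i * w) = T φ w := by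
      rw [T_mul_T, cs.simple_mul_simple_cancel_left]
      rw [cs.simple_mul_simple_cancel_left, cs.length_simple]; omega
    have h2 := ih (cs.simple i * w) (by omega)
    have h3 : bar φ (T φ w) - T φ w = leftOp φ i (bar φ (T φ (cs.simple i * w)) -
        T φ (cs.simple i * w)) - xi φ i • (bar φ (T φ (cs.simple i * w)) -
        T φ (cs.simple i * w)) - xi φ i • T φ (cs.simple i * w) := by
      rw [← h1, bar_T_simple_mul, ← T_simple_mul, bar_T_simple, sub_mul, smul_mul_assoc, one_mul,
        mul_sub, smul_sub]
      abel
    rw [h3]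
    exact sub_mem (sub_mem (leftOp_mem_lower h2 i) (Submodule.smul_mem _ _
      (lower_mono (by omega) h2))) (Submodule.smul_mem _ _ (T_mem_lower (by omega)))

theorem bar_mem_lower {n : ℕ} {h : Hecke cs φ} (hh : h ∈ lower cs φ n) :
    bar φ h ∈ lower cs φ n := by
  refine lower_induction hh ?_ (fun x y hx hy => ?_) (fun a w hw => ?_)
  · simp
  · rw [map_add]; exact add_mem hx hy
  · rw [map_smulₛₗ]
    refine Submodule.smul_mem _ _ ?_
    rw [← sub_add_cancel (bar φ (T φ w)) (T φ w)]
    exact add_mem (lower_mono hw.le (bar_T_sub_mem w)) (T_mem_lower hw)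

/-- On coefficients of maximal length, the bar involution acts by `barCoeff`. -/
theorem repr_bar {n : ℕ} {h : Hecke cs φ} (hh : h ∈ lower cs φ (n + 1)) (w : W)
    (hw : n ≤ cs.length w) :
    (T φ).repr (bar φ h) w = barCoeff Γ ((T φ).repr h w) := by
  refine lower_induction hh ?_ (fun x y hx hy => ?_) (fun a v hv => ?_)
  · simp
  · simp only [map_add, Finsupp.add_apply, hx, hy]
  · have h1 := bar_T_sub_mem (φ := φ) v w (by omega)
    rw [map_sub, Finsupp.sub_apply, sub_eq_zero] at h1
    rw [map_smulₛₗ, map_smul, Finsupp.smul_apply, h1, map_smul, Finsupp.smul_apply, smul_eq_mul,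
      smul_eq_mul, map_mul]
    congr 1
    rw [Module.Basis.repr_self]
    classical
    rw [Finsupp.single_apply]
    split_ifs
    · exact (map_one _).symm
    · exact (map_zero _).symm

theorem coeff_barCoeff (a : GroupRing Γ) (γ : Γ) : (barCoeff Γ a).coeff γ = a.coeff (-γ) := by
  have := Finsupp.mapDomain_apply (f := fun x : Γ => -x) neg_injective a.coeff (-γ)
  rwa [neg_neg] at this

end Bar

section KL

variable {B W : Type*} [Group W] {M : CoxeterMatrix B} {cs : CoxeterSystem M W}
variable {Γ : Type*} [AddCommGroup Γ] [LinearOrder Γ]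
variable {φ : SimpleClass cs → Γ}

/-- The subgroup `ℤ[Γ_{<0}]` of `ℤ[Γ]`. -/
def negCoeff (Γ : Type*) [AddCommGroup Γ] [LinearOrder Γ] : AddSubgroup (GroupRing Γ) where
  carrier := {a | ∀ γ, 0 ≤ γ → a.coeff γ = 0}
  zero_mem' := by simp
  add_mem' {a b} ha hb γ hγ := by simp [ha γ hγ, hb γ hγ]
  neg_mem' {a} ha γ hγ := by simp [ha γ hγ]

/-- The subgroup `⨁_w ℤ[Γ_{<0}] T_w` of the Hecke algebra. -/
def heckeNeg (cs : CoxeterSystem M W) (φ : SimpleClass cs → Γ) : AddSubgroup (Hecke cs φ) where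
  carrier := {h | ∀ w, (T φ).repr h w ∈ negCoeff Γ}
  zero_mem' w := by simp [zero_mem]
  add_mem' {x y} hx hy w := by simpa using add_mem (hx w) (hy w)
  neg_mem' {x} hx w := by simpa using neg_mem (hx w)

theorem mem_heckeNeg {h : Hecke cs φ} :
    h ∈ heckeNeg cs φ ↔ ∀ w, (T φ).repr h w ∈ negCoeff Γ := Iff.rfl

open Classical in
/-- The part of an element of `ℤ[Γ]` supported on negative elements. -/
def negPart (a : GroupRing Γ) : GroupRing Γ :=
  AddMonoidAlgebra.ofCoeff (a.coeff.filter (· < 0))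

theorem negPart_zero : negPart (0 : GroupRing Γ) = 0 := by
  ext γ
  simp [negPart, Finsupp.filter_apply]

theorem negPart_mem (a : GroupRing Γ) : negPart a ∈ negCoeff Γ := fun γ hγ => by
  simp [negPart, not_lt.2 hγ]

variable [IsOrderedAddMonoid Γ]

theorem eq_zero_of_negCoeff {a : GroupRing Γ} (ha : a ∈ negCoeff Γ) (h : barCoeff Γ a = a) :
    a = 0 := by
  ext γ
  rcases le_total 0 γ with hγ | hγ
  · exact ha γ hγ
  · rw [← h, coeff_barCoeff]
    exact ha _ (neg_nonneg.2 hγ)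

theorem negPart_sub (a : GroupRing Γ) (h : barCoeff Γ a = -a) :
    negPart a - barCoeff Γ (negPart a) = a := by
  ext γ
  have h1 : a.coeff (-γ) = -a.coeff γ := by
    rw [← coeff_barCoeff, h]; rfl
  change (negPart a).coeff γ - (barCoeff Γ (negPart a)).coeff γ = a.coeff γ
  rw [coeff_barCoeff]
  classical
  simp only [negPart, Finsupp.filter_apply, Left.neg_neg_iff, h1]
  rcases lt_trichotomy γ 0 with hγ | hγ | hγ
  · simp [hγ, hγ.le]
  · subst hγ
    rw [neg_zero] at h1
    simp
    omega
  · simp [hγ, hγ.le]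

theorem eq_zero_of_bar_eq {h : Hecke cs φ} (hneg : h ∈ heckeNeg cs φ) (hbar : bar φ h = h) :
    h = 0 := by
  obtain ⟨n, hn⟩ := exists_mem_lower h
  induction n with
  | zero => exact (T φ).repr.map_eq_zero_iff.1 (Finsupp.ext fun w => hn w (Nat.zero_le _))
  | succ n ih =>
    refine ih fun w hw => ?_
    refine eq_zero_of_negCoeff (hneg w) ?_
    rw [← repr_bar hn w hw, hbar]

theorem exists_sub_bar {n : ℕ} {r : Hecke cs φ} (hr : r ∈ lower cs φ n) (hbar : bar φ r = -r) :
    ∃ a ∈ lower cs φ n, a ∈ heckeNeg cs φ ∧ a - bar φ a = r := by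
  induction n generalizing r with
  | zero =>
    refine ⟨0, zero_mem _, zero_mem _, ?_⟩
    rw [map_zero, sub_zero]
    exact ((T φ).repr.map_eq_zero_iff.1 (Finsupp.ext fun w => hr w (Nat.zero_le _))).symm
  | succ n ih =>
    classical
    set a : Hecke cs φ := (T φ).repr.symm
      ((((T φ).repr r).filter fun w => n ≤ cs.length w).mapRange negPart negPart_zero) with ha
    have ha1 : ∀ w, (T φ).repr a w = if n ≤ cs.length w then negPart ((T φ).repr r w) else 0 := by
      intro w
      rw [ha, LinearEquiv.apply_symm_apply, Finsupp.mapRange_apply, Finsupp.filter_apply]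
      split_ifs
      · rfl
      · exact negPart_zero
    have ha2 : a ∈ lower cs φ (n + 1) := by
      intro w hw
      rw [ha1, if_pos (by omega), hr w hw, negPart_zero]
    have ha3 : a ∈ heckeNeg cs φ := by
      intro w
      rw [ha1]
      split_ifs
      · exact negPart_mem _
      · exact zero_mem _
    have h4 : r - (a - bar φ a) ∈ lower cs φ n := by
      intro w hw
      have h5 := repr_bar hr w hw
      rw [hbar, map_neg, Finsupp.neg_apply] at h5
      rw [map_sub, map_sub, Finsupp.sub_apply, Finsupp.sub_apply, repr_bar ha2 w hw, ha1,
        if_pos hw, negPart_sub _ h5.symm, sub_self]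
    obtain ⟨b, hb1, hb2, hb3⟩ := ih h4 (by
      rw [map_sub, map_sub, bar_bar, hbar]; abel)
    refine ⟨a + b, add_mem ha2 (lower_mono (Nat.le_succ n) hb1), add_mem ha3 hb2, ?_⟩
    rw [map_add, add_sub_add_comm, hb3]
    abel

variable (φ) in
/-- The existence and the uniqueness of the Kazhdan-Lusztig element of `w`. -/
theorem existsUnique_C (w : W) :
    ∃! c : Hecke cs φ, bar φ c = c ∧ c - T φ w ∈ heckeNeg cs φ := by
  obtain ⟨a, -, ha2, ha3⟩ := exists_sub_bar (bar_T_sub_mem (φ := φ) w) (by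
    rw [map_sub, bar_bar]; abel)
  refine ⟨T φ w + a, ⟨?_, by simpa using ha2⟩, ?_⟩
  · rw [map_add, ← sub_eq_zero]
    rw [sub_eq_iff_eq_add] at ha3
    nth_rewrite 2 [ha3]
    abel
  · rintro c ⟨hc1, hc2⟩
    have hb : bar φ (T φ w + a) = T φ w + a := by
      rw [map_add, ← sub_eq_zero]
      rw [sub_eq_iff_eq_add] at ha3
      nth_rewrite 2 [ha3]
      abel
    refine sub_eq_zero.1 (eq_zero_of_bar_eq ?_ (by rw [map_sub, hc1, hb]))
    have : c - (T φ w + a) = (c - T φ w) - a := by abel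
    rw [this]
    exact sub_mem hc2 ha2

variable (φ) in
/-- The Kazhdan-Lusztig element `C_w`: the unique bar invariant element of the Hecke algebra
congruent to `T_w` modulo `heckeNeg`. -/
def C (w : W) : Hecke cs φ := (existsUnique_C φ w).choose

theorem bar_C (w : W) : bar φ (C φ w) = C φ w := (existsUnique_C φ w).choose_spec.1.1

theorem C_sub_T_mem (w : W) : C φ w - T φ w ∈ heckeNeg cs φ :=
  (existsUnique_C φ w).choose_spec.1.2

theorem eq_C {w : W} {c : Hecke cs φ} (h1 : bar φ c = c) (h2 : c - T φ w ∈ heckeNeg cs φ) :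
    c = C φ w := (existsUnique_C φ w).choose_spec.2 c ⟨h1, h2⟩

theorem C_sub_T_mem_lower (w : W) : C φ w - T φ w ∈ lower cs φ (cs.length w) := by
  obtain ⟨a, ha1, ha2, ha3⟩ := exists_sub_bar (bar_T_sub_mem (φ := φ) w) (by
    rw [map_sub, bar_bar]; abel)
  have : T φ w + a = C φ w := by
    refine eq_C ?_ (by simpa using ha2)
    rw [map_add, ← sub_eq_zero]
    rw [sub_eq_iff_eq_add] at ha3
    nth_rewrite 2 [ha3]
    abel
  rw [← this]
  simpa using ha1

variable (φ) in
/-- The linear map sending `T_w` to `C_w`. -/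
def toC : Module.End (GroupRing Γ) (Hecke cs φ) := (T φ).constr (GroupRing Γ) (C φ)

theorem toC_T (w : W) : toC φ (T φ w) = C φ w := Module.Basis.constr_basis _ _ _ _

theorem toC_sub_mem {n : ℕ} {h : Hecke cs φ} (hh : h ∈ lower cs φ (n + 1)) :
    toC φ h - h ∈ lower cs φ n := by
  refine lower_induction hh ?_ (fun x y hx hy => ?_) (fun a w hw => ?_)
  · simp
  · rw [map_add, add_sub_add_comm]; exact add_mem hx hy
  · rw [map_smul, toC_T, ← smul_sub]
    exact Submodule.smul_mem _ _ (lower_mono (by omega) (C_sub_T_mem_lower w))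

theorem toC_bijective : Function.Bijective (toC (cs := cs) φ) := by
  constructor
  · rw [← LinearMap.ker_eq_bot, LinearMap.ker_eq_bot']
    intro h h0
    obtain ⟨n, hn⟩ := exists_mem_lower h
    induction n with
    | zero => exact (T φ).repr.map_eq_zero_iff.1 (Finsupp.ext fun w => hn w (Nat.zero_le _))
    | succ n ih =>
      have := toC_sub_mem hn
      rw [h0, zero_sub] at this
      exact ih (neg_mem_iff.1 this)
  · intro h
    obtain ⟨n, hn⟩ := exists_mem_lower h
    induction n generalizing h with
    | zero =>
      exact ⟨0, by rw [map_zero]; exact ((T φ).repr.map_eq_zero_iff.1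
        (Finsupp.ext fun w => hn w (Nat.zero_le _))).symm⟩
    | succ n ih =>
      obtain ⟨x, hx⟩ := ih _ (toC_sub_mem hn)
      exact ⟨h - x, by rw [map_sub, hx]; abel⟩

variable (φ) in
/-- The Kazhdan-Lusztig basis `(C_w)`. -/
def basisC : Module.Basis W (GroupRing Γ) (Hecke cs φ) :=
  (T φ).map (LinearEquiv.ofBijective (toC φ) toC_bijective)

theorem basisC_apply (w : W) : basisC φ w = C φ w := toC_T w

end KL

section Cells

/-- The three sides: left, right, two-sided. -/
inductive Side
  | L
  | R
  | LR

variable {B W : Type*} [Group W] {M : CoxeterMatrix B} {cs : CoxeterSystem M W}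
variable {Γ : Type*} [AddCommGroup Γ] [LinearOrder Γ] [IsOrderedAddMonoid Γ]

/-- The relation `x ← y`: the coefficient of `C_x` is nonzero in `h C_y` (left), in `C_y h` (right),
or in one of them (two-sided), for some element `h` of the Hecke algebra. -/
def Arrow (φ : SimpleClass cs → Γ) : Side → W → W → Prop
  | .L, x, y => ∃ h : Hecke cs φ, (basisC φ).repr (h * C φ y) x ≠ 0
  | .R, x, y => ∃ h : Hecke cs φ, (basisC φ).repr (C φ y * h) x ≠ 0
  | .LR, x, y => ∃ h : Hecke cs φ,
      (basisC φ).repr (h * C φ y) x ≠ 0 ∨ (basisC φ).repr (C φ y * h) x ≠ 0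

/-- The preorder `x ≤ y`, the transitive closure of the relation `x ← y`. -/
def CellLE (φ : SimpleClass cs → Γ) (d : Side) : W → W → Prop := Relation.TransGen (Arrow φ d)

/-- The equivalence relation associated with the preorder. -/
def CellEquiv (φ : SimpleClass cs → Γ) (d : Side) (x y : W) : Prop :=
  CellLE φ d x y ∧ CellLE φ d y x

/-- The cell of `w`. -/
def Cell (φ : SimpleClass cs → Γ) (d : Side) (w : W) : Set W := {x | CellEquiv φ d x w}

end Cells

end HeckeKL
end

/-! The map `ρ_*` commutes with left multiplication by the elements `T_s`, hence is multiplicative,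
hence preserves the inverses `T_{w⁻¹}⁻¹` and commutes with the bar involutions. As `ρ` is strictly
increasing it carries `ℤ[Γ_{<0}]` into `ℤ[Γ'_{<0}]`, so that `ρ_*(C_w)` has the two properties
characterizing `C_w`. Thus `ρ_*` sends the Kazhdan-Lusztig basis to the Kazhdan-Lusztig basis and
acts on coefficients through the injective morphism `ℤ[Γ] → ℤ[Γ']`. The relation `x ← y` can be
tested on the products of `C_y` with the elements `T_w` alone, which lie in the image of `ρ_*`. -/

section Semilinear

variable {R S ι M N : Type*} [Semiring R] [Semiring S] {σ : R →+* S} [AddCommMonoid M]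
  [AddCommMonoid N] [Module R M] [Module S N] {b : Module.Basis ι R M} {c : Module.Basis ι S N}
  {f : M →ₛₗ[σ] N}

theorem basis_repr_map_apply (hf : ∀ i, f (b i) = c i) (x : M) (i : ι) :
    c.repr (f x) i = σ (b.repr x i) := by
  classical
  have h : (c.coord i).comp f = σ.toSemilinearMap.comp (b.coord i) :=
    b.ext fun j => by simp [hf, Finsupp.single_apply, apply_ite σ]
  exact LinearMap.congr_fun h x

theorem injective_of_map_basis (hσ : Function.Injective σ) (hf : ∀ i, f (b i) = c i) :
    Function.Injective f := fun x y hxy =>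
  b.ext_elem fun i => hσ <| by
    rw [← basis_repr_map_apply hf, ← basis_repr_map_apply hf, hxy]

theorem exists_map_ne_zero_iff_exists_basis (b : Module.Basis ι R M) (f : M →ₛₗ[σ] N) :
    (∃ x, f x ≠ 0) ↔ ∃ i, f (b i) ≠ 0 := by
  refine ⟨fun ⟨x, hx⟩ => ?_, fun ⟨i, hi⟩ => ⟨b i, hi⟩⟩
  contrapose! hx
  exact LinearMap.congr_fun (b.ext (f₂ := 0) hx) x

end Semilinear

theorem map_ringInverse {M N F : Type*} [MonoidWithZero M] [MonoidWithZero N] [FunLike F M N]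
    [MonoidHomClass F M N] (f : F) {a : M} (ha : IsUnit a) :
    f (Ring.inverse a) = Ring.inverse (f a) := by
  obtain ⟨u, rfl⟩ := ha
  rw [Ring.inverse_unit]
  exact (Ring.inverse_unit (Units.map (f : M →* N) u)).symm

namespace HeckeKL

section GroupRing

variable {Γ Γ' : Type*} [AddCommGroup Γ] [AddCommGroup Γ'] {ρ : Γ →+ Γ'}

theorem groupRingMap_injective (hρ : Function.Injective ρ) :
    Function.Injective (groupRingMap ρ) := AddMonoidAlgebra.mapDomain_injective hρ

theorem groupRingMap_comp_barCoeff :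
    (groupRingMap ρ).comp (barCoeff Γ) = (barCoeff Γ').comp (groupRingMap ρ) := by
  have h : ρ.comp negAddMonoidHom = negAddMonoidHom.comp ρ := AddMonoidHom.ext (map_neg ρ)
  rw [← AddMonoidAlgebra.mapDomainRingHom_comp, ← AddMonoidAlgebra.mapDomainRingHom_comp, h]

theorem groupRingMap_mem_negCoeff [LinearOrder Γ] [LinearOrder Γ'] (hρ : StrictMono ρ)
    {a : GroupRing Γ} (ha : a ∈ negCoeff Γ) : groupRingMap ρ a ∈ negCoeff Γ' := by
  intro γ hγ
  by_contra h
  obtain ⟨δ, rfl⟩ := Finsupp.mem_range_of_mapDomain_ne_zero h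
  have hδ : 0 ≤ δ := hρ.le_iff_le.1 (by rwa [map_zero])
  exact h ((Finsupp.mapDomain_apply hρ.injective _ _).trans (ha δ hδ))

end GroupRing

section Pushforward

variable {B W : Type*} [Group W] {M : CoxeterMatrix B} {cs : CoxeterSystem M W}
variable {Γ Γ' : Type*} [AddCommGroup Γ] [AddCommGroup Γ']
variable {φ : SimpleClass cs → Γ} {ρ : Γ →+ Γ'}

theorem pushforward_T (w : W) : pushforward φ ρ (T φ w) = T (ρ ∘ φ) w := semiConstr_T _ _ _

theorem pushforward_injective (hρ : Function.Injective ρ) :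
    Function.Injective (pushforward φ ρ) :=
  injective_of_map_basis (groupRingMap_injective hρ) pushforward_T

theorem groupRingMap_xi (i : B) : groupRingMap ρ (xi φ i) = xi (ρ ∘ φ) i := by
  simp only [xi, map_sub, groupRingMap_expo, map_neg, Function.comp_apply]

theorem pushforward_leftOp (i : B) (h : Hecke cs φ) :
    pushforward φ ρ (leftOp φ i h) = leftOp (ρ ∘ φ) i (pushforward φ ρ h) := by
  suffices (pushforward φ ρ).comp (leftOp φ i) = (leftOp (ρ ∘ φ) i).comp (pushforward φ ρ) from
    LinearMap.congr_fun this h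
  refine (T φ).ext fun w => ?_
  simp only [LinearMap.comp_apply, leftOp_T, pushforward_T, map_add, map_smulₛₗ,
    apply_ite (groupRingMap ρ), groupRingMap_xi, map_zero]

theorem pushforward_wordOp (ω : List B) (h : Hecke cs φ) :
    pushforward φ ρ (wordOp φ ω h) = wordOp (ρ ∘ φ) ω (pushforward φ ρ h) := by
  induction ω with
  | nil => rfl
  | cons i ω ih =>
    simp only [wordOp, List.map_cons, List.prod_cons, Module.End.mul_apply] at ih ⊢
    rw [pushforward_leftOp, ih]

theorem pushforward_mul (h k : Hecke cs φ) :
    pushforward φ ρ (h * k) = pushforward φ ρ h * pushforward φ ρ k := by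
  induction h using hecke_induction with
  | zero => simp
  | add x y hx hy => simp only [add_mul, map_add, hx, hy]
  | smul a w =>
    simp only [smul_mul_assoc, map_smulₛₗ, pushforward_T, mul_def, mulMap_T, pushforward_wordOp]

variable (φ ρ) in
/-- The map `ρ_*` as a morphism of rings. -/
noncomputable def pushforwardRingHom : Hecke cs φ →+* Hecke cs (ρ ∘ φ) where
  __ := (pushforward φ ρ).toAddMonoidHom
  map_one' := pushforward_T 1
  map_mul' := pushforward_mul

theorem pushforward_bar_T (w : W) :
    pushforward φ ρ (bar φ (T φ w)) = bar (ρ ∘ φ) (T (ρ ∘ φ) w) := by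
  rw [bar_T, bar_T, ← pushforward_T]
  exact map_ringInverse (pushforwardRingHom φ ρ) (isUnit_T w⁻¹)

theorem pushforward_bar (h : Hecke cs φ) :
    pushforward φ ρ (bar φ h) = bar (ρ ∘ φ) (pushforward φ ρ h) := by
  let σ : GroupRing Γ →+* GroupRing Γ' := (barCoeff Γ').comp (groupRingMap ρ)
  have : RingHomCompTriple (barCoeff Γ) (groupRingMap ρ) σ := ⟨groupRingMap_comp_barCoeff⟩
  have : RingHomCompTriple (groupRingMap ρ) (barCoeff Γ') σ := ⟨rfl⟩
  suffices ((pushforward φ ρ).comp (bar φ) : Hecke cs φ →ₛₗ[σ] Hecke cs (ρ ∘ φ)) =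
      (bar (ρ ∘ φ)).comp (pushforward φ ρ) from LinearMap.congr_fun this h
  refine (T φ).ext fun w => ?_
  rw [LinearMap.comp_apply, LinearMap.comp_apply, pushforward_bar_T, pushforward_T]

end Pushforward

section KazhdanLusztig

variable {B W : Type*} [Group W] {M : CoxeterMatrix B} {cs : CoxeterSystem M W}
variable {Γ Γ' : Type*} [AddCommGroup Γ] [LinearOrder Γ] [AddCommGroup Γ'] [LinearOrder Γ']
variable {φ : SimpleClass cs → Γ} {ρ : Γ →+ Γ'}

theorem pushforward_mem_heckeNeg (hρ : StrictMono ρ) {h : Hecke cs φ}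
    (hh : h ∈ heckeNeg cs φ) : pushforward φ ρ h ∈ heckeNeg cs (ρ ∘ φ) := fun w => by
  rw [basis_repr_map_apply pushforward_T]
  exact groupRingMap_mem_negCoeff hρ (hh w)

variable [IsOrderedAddMonoid Γ] [IsOrderedAddMonoid Γ']

theorem pushforward_C (hρ : StrictMono ρ) (w : W) :
    pushforward φ ρ (C φ w) = C (ρ ∘ φ) w := by
  refine eq_C ?_ ?_
  · rw [← pushforward_bar, bar_C]
  · rw [← pushforward_T, ← map_sub]
    exact pushforward_mem_heckeNeg hρ (C_sub_T_mem w)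

theorem basisC_repr_pushforward_ne_zero_iff (hρ : StrictMono ρ) (h : Hecke cs φ) (w : W) :
    (basisC (ρ ∘ φ)).repr (pushforward φ ρ h) w ≠ 0 ↔ (basisC φ).repr h w ≠ 0 := by
  have map_basisC (v : W) : pushforward φ ρ (basisC φ v) = basisC (ρ ∘ φ) v := by
    rw [basisC_apply, basisC_apply, pushforward_C hρ]
  rw [basis_repr_map_apply map_basisC,
    map_ne_zero_iff (groupRingMap ρ) (groupRingMap_injective hρ.injective)]

end KazhdanLusztig

section Cells

variable {B W : Type*} [Group W] {M : CoxeterMatrix B} {cs : CoxeterSystem M W}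
variable {Γ Γ' : Type*} [AddCommGroup Γ] [LinearOrder Γ] [IsOrderedAddMonoid Γ]
variable [AddCommGroup Γ'] [LinearOrder Γ'] [IsOrderedAddMonoid Γ']
variable {φ : SimpleClass cs → Γ} {ρ : Γ →+ Γ'}

theorem arrow_L_iff {x y : W} :
    Arrow φ .L x y ↔ ∃ w, (basisC φ).repr (T φ w * C φ y) x ≠ 0 :=
  exists_map_ne_zero_iff_exists_basis (T φ)
    ((basisC φ).coord x ∘ₗ LinearMap.mulRight (GroupRing Γ) (C φ y))

theorem arrow_R_iff {x y : W} :
    Arrow φ .R x y ↔ ∃ w, (basisC φ).repr (C φ y * T φ w) x ≠ 0 :=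
  exists_map_ne_zero_iff_exists_basis (T φ)
    ((basisC φ).coord x ∘ₗ LinearMap.mulLeft (GroupRing Γ) (C φ y))

theorem arrow_LR_iff {x y : W} : Arrow φ .LR x y ↔ Arrow φ .L x y ∨ Arrow φ .R x y :=
  exists_or

theorem arrow_L_comp_iff (hρ : StrictMono ρ) {x y : W} :
    Arrow (ρ ∘ φ) .L x y ↔ Arrow φ .L x y := by
  simp only [arrow_L_iff, ← pushforward_T, ← pushforward_C hρ, ← pushforward_mul,
    basisC_repr_pushforward_ne_zero_iff hρ]

theorem arrow_R_comp_iff (hρ : StrictMono ρ) {x y : W} :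
    Arrow (ρ ∘ φ) .R x y ↔ Arrow φ .R x y := by
  simp only [arrow_R_iff, ← pushforward_T, ← pushforward_C hρ, ← pushforward_mul,
    basisC_repr_pushforward_ne_zero_iff hρ]

theorem arrow_comp (hρ : StrictMono ρ) (d : Side) : Arrow (ρ ∘ φ) d = Arrow φ d := by
  ext x y
  cases d with
  | L => exact arrow_L_comp_iff hρ
  | R => exact arrow_R_comp_iff hρ
  | LR => rw [arrow_LR_iff, arrow_LR_iff, arrow_L_comp_iff hρ, arrow_R_comp_iff hρ]

theorem cellLE_comp (hρ : StrictMono ρ) (d : Side) : CellLE (ρ ∘ φ) d = CellLE φ d := by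
  rw [CellLE, CellLE, arrow_comp hρ]

theorem cellEquiv_comp (hρ : StrictMono ρ) (d : Side) :
    CellEquiv (ρ ∘ φ) d = CellEquiv φ d := by
  funext x y
  rw [CellEquiv, CellEquiv, cellLE_comp hρ]

theorem cell_comp (hρ : StrictMono ρ) (d : Side) (w : W) : Cell (ρ ∘ φ) d w = Cell φ d w := by
  rw [Cell, Cell, cellEquiv_comp hρ]

end Cells

end HeckeKL

theorem mainTheorem6 {B W : Type*} [Group W] {M : CoxeterMatrix B} (cs : CoxeterSystem M W)
    {Γ Γ' : Type*}
    [AddCommGroup Γ] [LinearOrder Γ] [IsOrderedAddMonoid Γ]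
    [AddCommGroup Γ'] [LinearOrder Γ'] [IsOrderedAddMonoid Γ']
    (φ : HeckeKL.SimpleClass cs → Γ) (ρ : Γ →+ Γ') (hρ : StrictMono ρ) (d : HeckeKL.Side) :
    Function.Injective (HeckeKL.pushforward φ ρ) ∧
    (∀ w : W, HeckeKL.pushforward φ ρ (HeckeKL.C φ w) = HeckeKL.C (ρ ∘ φ) w) ∧
    ((∀ x y : W, HeckeKL.CellLE φ d x y ↔ HeckeKL.CellLE (ρ ∘ φ) d x y) ∧
      (∀ x y : W, HeckeKL.CellEquiv φ d x y ↔ HeckeKL.CellEquiv (ρ ∘ φ) d x y)) ∧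
    (∀ w : W, HeckeKL.Cell φ d w = HeckeKL.Cell (ρ ∘ φ) d w) := by
  refine ⟨HeckeKL.pushforward_injective hρ.injective, HeckeKL.pushforward_C hρ,
    ⟨fun x y => ?_, fun x y => ?_⟩, fun w => (HeckeKL.cell_comp hρ d w).symm⟩
  · rw [HeckeKL.cellLE_comp hρ]
  · rw [HeckeKL.cellEquiv_comp hρ]
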